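/- Let $G$ be a simple graph embedded in the Euclidean plane (vertices are distinct points, edges are simple arcs joining their end vertices, no arc contains a vertex other than its end vertices, and two different arcs meet only at common end vertices). For a cycle $C$ of $G$, a vertex of $G$ is inside (respectively outside) $C$ if it does not lie on the closed curve formed by the arcs of the edges of $C$ and lies in a bounded (respectively unbounded) connected component of the complement of that curve in the plane. Let $X$ and $Y$ be cycles in $G$ and let $x$ be a vertex of $G$ with $x\notin V(X)\cup V(Y)$. If $x$ is adjacent to every vertex of $X$ and to every vertex of $Y$, then $X$ does not have both a vertex inside $Y$ and a vertex outside $Y$. -/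

import Mathlib

/-- The Euclidean plane. -/
abbrev Plane : Type := EuclideanSpace ℝ (Fin 2)

/-- An embedding of a simple graph in the plane: vertices are distinct points, each edge is a simple
arc joining its end vertices, no other vertex lies on the arc, and two different arcs meet only at
common end vertices. The values of `arc` at non-edges are irrelevant. -/
structure PlaneEmbedding {V : Type*} (G : SimpleGraph V) where
  /-- the point that represents a vertex -/
  point : V → Plane
  /-- the point set of the curve that represents an edge -/
  arc : Sym2 V → Set Plane
  point_injective : Function.Injective point
  isArc : ∀ u v : V, G.Adj u v →
    ∃ γ : Path (point u) (point v), Function.Injective γ ∧ Set.range γ = arc s(u, v)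
  mem_of_point_mem_arc : ∀ e ∈ G.edgeSet, ∀ w : V, point w ∈ arc e → w ∈ e
  arc_inter : ∀ e ∈ G.edgeSet, ∀ f ∈ G.edgeSet, e ≠ f →
    ∀ z ∈ arc e ∩ arc f, ∃ w : V, w ∈ e ∧ w ∈ f ∧ point w = z

namespace PlaneEmbedding

variable {V : Type*} {G : SimpleGraph V}

/-- The closed curve traced by a closed walk (in particular by a cycle): the union of the arcs of
its edges. -/
def curve (D : PlaneEmbedding G) {a : V} (C : G.Walk a a) : Set Plane :=
  {z | ∃ e ∈ C.edges, z ∈ D.arc e}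

/-- The vertex `v` lies (strictly) inside `C`: it is not on the curve of `C`, and it lies in a
bounded connected component of the complement of that curve. -/
def IsInside (D : PlaneEmbedding G) {a : V} (C : G.Walk a a) (v : V) : Prop :=
  D.point v ∉ D.curve C ∧
    Bornology.IsBounded (connectedComponentIn (D.curve C)ᶜ (D.point v))

/-- The vertex `v` lies (strictly) outside `C`: it is not on the curve of `C`, and it lies in an
unbounded connected component of the complement of that curve. -/
def IsOutside (D : PlaneEmbedding G) {a : V} (C : G.Walk a a) (v : V) : Prop :=
  D.point v ∉ D.curve C ∧
    ¬ Bornology.IsBounded (connectedComponentIn (D.curve C)ᶜ (D.point v))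

end PlaneEmbedding

/-! The arc from `x` to a vertex of `X` off the curve of `Y` is connected and misses that curve, so
all such vertices share the component of `x`. That single component cannot be both bounded and
unbounded; the Jordan curve theorem is not needed. -/

namespace PlaneEmbedding

/-- The arc of an edge `xv` avoids the curve of `C` when `x` is not on `C` and `v` is not on the
curve: it could meet the curve only in a common end vertex. -/
theorem arc_subset_compl_curve {V : Type*} {G : SimpleGraph V} (D : PlaneEmbedding G)
    {b x v : V} (C : G.Walk b b) (hx : x ∉ C.support) (hxv : G.Adj x v)
    (hv : D.point v ∉ D.curve C) : D.arc s(x, v) ⊆ (D.curve C)ᶜ := by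
  rintro z hz ⟨e, he, hze⟩
  have hxe : x ∉ e := fun h => hx (C.mem_support_of_mem_edges he h)
  have hne : s(x, v) ≠ e := by
    rintro rfl
    exact hxe (Sym2.mem_mk_left x v)
  obtain ⟨w, hw, hwe, rfl⟩ :=
    D.arc_inter s(x, v) hxv e (C.edges_subset_edgeSet he) hne z ⟨hz, hze⟩
  rcases Sym2.mem_iff.1 hw with rfl | rfl
  · exact hxe hwe
  · exact hv ⟨e, he, hze⟩

/-- A vertex off `C` lies in the same component of the complement of the curve of `C` as each of
its neighbours that is not on the curve. -/
theorem connectedComponentIn_eq_of_adj {V : Type*} {G : SimpleGraph V} (D : PlaneEmbedding G)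
    {b x v : V} (C : G.Walk b b) (hx : x ∉ C.support) (hxv : G.Adj x v)
    (hv : D.point v ∉ D.curve C) :
    connectedComponentIn (D.curve C)ᶜ (D.point x) =
      connectedComponentIn (D.curve C)ᶜ (D.point v) := by
  obtain ⟨γ, -, hγ⟩ := D.isArc x v hxv
  have hconn : IsPreconnected (D.arc s(x, v)) := hγ ▸ isPreconnected_range γ.continuous
  have hmx : D.point x ∈ D.arc s(x, v) := hγ ▸ ⟨0, γ.source⟩
  have hmv : D.point v ∈ D.arc s(x, v) := hγ ▸ ⟨1, γ.target⟩
  exact connectedComponentIn_eq (hconn.subset_connectedComponentIn hmx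
    (D.arc_subset_compl_curve C hx hxv hv) hmv)

end PlaneEmbedding

theorem theorem2 {V : Type*} (G : SimpleGraph V) (D : PlaneEmbedding G)
    {a b : V} (X : G.Walk a a) (Y : G.Walk b b) (hX : X.IsCycle) (hY : Y.IsCycle)
    (x : V) (hx : x ∉ {v | v ∈ X.support} ∪ {v | v ∈ Y.support})
    (hadjX : ∀ v ∈ X.support, G.Adj x v) (hadjY : ∀ v ∈ Y.support, G.Adj x v) :
    ¬ ((∃ u ∈ X.support, D.IsInside Y u) ∧ (∃ v ∈ X.support, D.IsOutside Y v)) := by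
  rintro ⟨⟨u, hu, hu_off, hu_bdd⟩, v, hv, hv_off, hv_unbdd⟩
  have hxY : x ∉ Y.support := fun h => hx (Or.inr h)
  -- Both boundedness claims are moved to the component of `x`, where they clash.
  rw [← D.connectedComponentIn_eq_of_adj Y hxY (hadjX u hu) hu_off] at hu_bdd
  rw [← D.connectedComponentIn_eq_of_adj Y hxY (hadjX v hv) hv_off] at hv_unbdd
  exact hv_unbdd hu_bdd
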